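/- Let $p$ be an odd prime and $q\neq p$ a prime, and put $n=q^2$. Suppose that $x^n-1=(x-1)ab$ in $\mathbb{Z}_{p^2}[x]$ with $a,b$ monic, where the reductions modulo $p$ are $\bar a=1+x+\cdots+x^{q-1}$ and $\bar b=1+x^q+\cdots+x^{(q-1)q}$, and that $\bar a$ and $\bar b$ are irreducible over $\mathbb{F}_p$. Let $f,g,h\in\mathbb{Z}_{p^2}[x]$ be monic with $fhg=x^n-1$, and let $\mathcal{C}=\langle fh+pf\rangle\subseteq\mathbb{Z}_{p^2}^n$ be the cyclic code corresponding to the ideal generated by $fh+pf$ in $\mathbb{Z}_{p^2}[x]/(x^n-1)$ under $(c_0,\dots,c_{n-1})\leftrightarrow c_0+c_1x+\cdots+c_{n-1}x^{n-1}$. Let $\Phi:\mathbb{Z}_{p^2}^n\to\mathbb{Z}_p^{pn}$ be the Gray map $\Phi(y_1,\dots,y_n)=(\phi(y_1),\dots,\phi(y_n))$, where $\phi(\theta_0p+\theta_1)=\theta_0(1,1,\dots,1)+\theta_1(0,1,\dots,p-1)\in\mathbb{Z}_p^p$ for $0\le\theta_0,\theta_1<p$. Call $\Phi(\mathcal{C})$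 linear if it is a $\mathbb{Z}_p$-subspace of $\mathbb{Z}_p^{pn}$. Then: (1) if $f=1$, or $g=1$, or $g=x-1$, then $\Phi(\mathcal{C})$ is linear; (2) if $f\neq 1$, $g\neq 1$ and $g\neq x-1$, then $\Phi(\mathcal{C})$ is linear if and only if $f=b$ and $g\in\{a,(x-1)a\}$. -/

import Mathlib

open Polynomial

/-- The Gray map `φ : ℤ/p² → (ℤ/p)^p`: writing `θ = θ₀ p + θ₁` with `0 ≤ θ₀, θ₁ < p`,
`φ(θ) = θ₀ (1, 1, …, 1) + θ₁ (0, 1, …, p - 1)`. -/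
def grayMap (p : ℕ) (θ : ZMod (p ^ 2)) : Fin p → ZMod p :=
  fun j => ((θ.val / p : ℕ) : ZMod p) + ((θ.val % p : ℕ) : ZMod p) * ((j : ℕ) : ZMod p)

/-- The coordinatewise extension `Φ(y₁, …, yₙ) = (φ(y₁), …, φ(yₙ))` of the Gray map. The `pn`
coordinates of the image are indexed by pairs (block, position inside the block). -/
def grayMapVec (p n : ℕ) (y : Fin n → ZMod (p ^ 2)) : Fin n × Fin p → ZMod p :=
  fun ij => grayMap p (y ij.1) ij.2

/-- The polynomial `c₀ + c₁ x + … + c_{n-1} x^{n-1}` attached to a vector. -/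
noncomputable def vecToPoly {R : Type*} [CommRing R] {n : ℕ} (c : Fin n → R) : R[X] :=
  ∑ i : Fin n, C (c i) * X ^ (i : ℕ)

/-- The cyclic code `⟨s⟩` of length `n` over `R`: the vectors whose polynomial lies in the ideal
generated by (the class of) `s` in `R[x] / (x^n - 1)`. -/
def cyclicCode {R : Type*} [CommRing R] (n : ℕ) (s : R[X]) : Set (Fin n → R) :=
  {c | Ideal.Quotient.mk (Ideal.span {(X ^ n - 1 : R[X])}) (vecToPoly c) ∈
    Ideal.span {Ideal.Quotient.mk (Ideal.span {(X ^ n - 1 : R[X])}) s}}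

/-- A code (a set of vectors) over the field `ℤ/p` is linear if it is a `ℤ/p`-subspace. -/
def IsLinearCode {p : ℕ} {ι : Type*} (D : Set (ι → ZMod p)) : Prop :=
  ∃ S : Submodule (ZMod p) (ι → ZMod p), (S : Set (ι → ZMod p)) = D

/-- The reduction modulo `p` of a polynomial over `ℤ/p²`. -/
noncomputable def redPoly (p : ℕ) (s : (ZMod (p ^ 2))[X]) : (ZMod p)[X] :=
  s.map (ZMod.castHom (dvd_pow_self p two_ne_zero) (ZMod p))

/-! The Gray map adds base-`p` digits separately, while addition in `ℤ/p²` carries, so `φ(x) + φ(y)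
= φ(x + y - p·carry)`. By injectivity, the image of an additive code is linear iff it contains `p`
times each carry vector. Here `⟨fh + pf⟩ = ⟨fh, pf⟩`, so the criterion lives over `𝔽_p`: carries of
words of the residue code `⟨fh⟩` must lie in the torsion code `⟨f⟩`
(`isLinearCode_iff_dvd_carryVec`).

The linear cases hold because carries of periodic words are periodic: multiples of `(x^n - 1)/(x^m -
1)` are the words invariant under shift by `m`, with `m = 1` for `g = x - 1` and `m = q` for `f =
b`.

Otherwise, doubling a word with entries in `{1, 0, -1}` marks its `-1` entries. If `b ∣ g`, doubling
`x^q - 1` gives the carry polynomial `1`, forcing `f = 1`. If `g` is `a` or `(x - 1)a`, doubling `(x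
- 1)b` gives `b`, whose value at `1` is `q ≠ 0`, so `x - 1 ∤ f` and only `f = b` survives. -/

/-! ### The Gray map and carries. -/

/-- The carry of the base-`p` addition of the lowest digits of `x` and `y`. -/
def digitCarry (p : ℕ) (x y : ZMod (p ^ 2)) : ℕ :=
  (x.val % p + y.val % p) / p

theorem grayMap_natCast {p : ℕ} (hp : 0 < p) (s t : ℕ) (ht : t < p) :
    grayMap p ((p * s + t : ℕ) : ZMod (p ^ 2)) = fun j : Fin p => (s : ZMod p) + t * ((j : ℕ) : ZMod p) := by
  funext j
  have h1 : ((p * s + t : ℕ) : ZMod (p ^ 2)).val / p = s % p := by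
    rw [ZMod.val_natCast, pow_two, Nat.mod_mul_right_div_self, Nat.mul_add_div hp,
      Nat.div_eq_of_lt ht, add_zero]
  have h2 : ((p * s + t : ℕ) : ZMod (p ^ 2)).val % p = t := by
    rw [ZMod.val_natCast, pow_two, Nat.mod_mul_right_mod, Nat.mul_add_mod, Nat.mod_eq_of_lt ht]
  simp only [grayMap, h1, h2, ZMod.natCast_mod]

theorem natCast_div_add_mod {p : ℕ} (hp : 0 < p) (x : ZMod (p ^ 2)) :
    ((p * (x.val / p) + x.val % p : ℕ) : ZMod (p ^ 2)) = x := by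
  have : NeZero (p ^ 2) := ⟨(pow_pos hp 2).ne'⟩
  rw [Nat.div_add_mod, ZMod.natCast_val, ZMod.cast_id]

/-- The correction by `p` times the carry removes exactly what addition in `ℤ/p²` moves from the low
digit to the high one. -/
theorem grayMap_add {p : ℕ} (hp : 0 < p) (x y : ZMod (p ^ 2)) :
    grayMap p x + grayMap p y = grayMap p (x + y - (p : ZMod (p ^ 2)) * (digitCarry p x y : ℕ)) := by
  have e : x + y - (p : ZMod (p ^ 2)) * (digitCarry p x y : ℕ) =
      ((p * (x.val / p + y.val / p) + (x.val % p + y.val % p) % p : ℕ) : ZMod (p ^ 2)) := by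
    have h := Nat.div_add_mod (x.val % p + y.val % p) p
    have h' := congrArg (Nat.cast : ℕ → ZMod (p ^ 2)) h
    rw [digitCarry]
    have hx := natCast_div_add_mod hp x
    have hy := natCast_div_add_mod hp y
    push_cast at h' hx hy ⊢
    linear_combination -hx - hy - h'
  rw [e, grayMap_natCast hp _ _ (Nat.mod_lt _ hp)]
  funext j
  simp only [Pi.add_apply, grayMap, ZMod.natCast_mod (x.val % p + y.val % p), Nat.cast_add]
  ring

theorem grayMap_zero (p : ℕ) : grayMap p 0 = 0 := by
  funext j
  simp [grayMap]

theorem grayMap_injective {p : ℕ} (hp : 1 < p) : Function.Injective (grayMap p) := by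
  have hp0 : 0 < p := by omega
  have : NeZero (p ^ 2) := ⟨(pow_pos hp0 2).ne'⟩
  intro x y h
  have hlt : ∀ z : ZMod (p ^ 2), z.val / p < p := fun z =>
    Nat.div_lt_of_lt_mul (by rw [← pow_two]; exact z.val_lt)
  have inj : ∀ s t : ℕ, s < p → t < p → (s : ZMod p) = t → s = t := fun s t hs ht e => by
    have := (ZMod.natCast_eq_natCast_iff' s t p).1 e
    rwa [Nat.mod_eq_of_lt hs, Nat.mod_eq_of_lt ht] at this
  -- Coordinates `0` and `1` of the image are `θ₀` and `θ₀ + θ₁`, which determine both digits.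
  have h0 := congrFun h ⟨0, hp0⟩
  have h1 := congrFun h ⟨1, hp⟩
  simp only [grayMap, Nat.cast_zero, mul_zero, add_zero, Nat.cast_one, mul_one] at h0 h1
  rw [h0] at h1
  have e0 := inj _ _ (hlt x) (hlt y) h0
  have e1 := inj _ _ (Nat.mod_lt _ hp0) (Nat.mod_lt _ hp0) (add_left_cancel h1)
  rw [← natCast_div_add_mod hp0 x, ← natCast_div_add_mod hp0 y, e0, e1]

theorem grayMapVec_injective {p : ℕ} (hp : 1 < p) (n : ℕ) :
    Function.Injective (grayMapVec p n) := fun _ _ h =>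
  funext fun i => grayMap_injective hp (funext fun j => congrFun h (i, j))

theorem grayMapVec_add {p n : ℕ} (hp : 0 < p) (c d : Fin n → ZMod (p ^ 2)) :
    grayMapVec p n c + grayMapVec p n d = grayMapVec p n
      (c + d - fun i => (p : ZMod (p ^ 2)) * (digitCarry p (c i) (d i) : ℕ)) :=
  funext fun ij => congrFun (grayMap_add hp (c ij.1) (d ij.1)) ij.2

/-- The Gray image of an additive code is linear exactly when `p` times every carry vector of two
codewords is a codeword. -/
theorem isLinearCode_grayMapVec_image_iff {p n : ℕ} (hp : 1 < p)
    (D : AddSubgroup (Fin n → ZMod (p ^ 2))) :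
    IsLinearCode (grayMapVec p n '' (D : Set (Fin n → ZMod (p ^ 2)))) ↔ ∀ c ∈ D, ∀ d ∈ D,
      (fun i => (p : ZMod (p ^ 2)) * (digitCarry p (c i) (d i) : ℕ)) ∈ D := by
  have hp0 : 0 < p := by omega
  have : NeZero p := ⟨hp0.ne'⟩
  constructor
  · rintro ⟨S, hS⟩ c hc d hd
    have h : grayMapVec p n c + grayMapVec p n d ∈ (S : Set (Fin n × Fin p → ZMod p)) :=
      S.add_mem (hS.ge (Set.mem_image_of_mem _ hc)) (hS.ge (Set.mem_image_of_mem _ hd))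
    rw [hS, grayMapVec_add hp0] at h
    obtain ⟨e, he, hee⟩ := h
    rw [grayMapVec_injective hp n hee] at he
    have := D.sub_mem (D.add_mem hc hd) he
    rwa [sub_sub_cancel] at this
  · intro h
    let M : AddSubmonoid (Fin n × Fin p → ZMod p) :=
      { carrier := grayMapVec p n '' (D : Set (Fin n → ZMod (p ^ 2)))
        zero_mem' := ⟨0, D.zero_mem, funext fun ij => congrFun (grayMap_zero p) ij.2⟩
        add_mem' := by
          rintro _ _ ⟨c, hc, rfl⟩ ⟨d, hd, rfl⟩
          exact ⟨_, D.sub_mem (D.add_mem hc hd) (h c hc d hd), (grayMapVec_add hp0 c d).symm⟩ }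
    refine ⟨{ M with smul_mem' := fun r x hx => ?_ }, rfl⟩
    -- Scalars of `ℤ/p` act as natural multiples, so closure under addition suffices.
    have e : r • x = r.val • x := by
      rw [← Nat.cast_smul_eq_nsmul (ZMod p), ZMod.natCast_zmod_val]
    rw [e]
    exact M.nsmul_mem hx _

theorem digitCarry_eq {p : ℕ} [NeZero p] (x y : ZMod (p ^ 2)) :
    digitCarry p x y = ((ZMod.castHom (dvd_pow_self p two_ne_zero) (ZMod p) x).val +
      (ZMod.castHom (dvd_pow_self p two_ne_zero) (ZMod p) y).val) / p := by
  have h : ∀ z : ZMod (p ^ 2),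
      (ZMod.castHom (dvd_pow_self p two_ne_zero) (ZMod p) z).val = z.val % p := by
    intro z
    rw [ZMod.castHom_apply, ZMod.cast_eq_val, ZMod.val_natCast]
  rw [digitCarry, h, h]

/-! ### Reduction modulo `p` and lifting of coprimality. -/

section Reduction

variable {p : ℕ}

theorem redPoly_mul (s t : (ZMod (p ^ 2))[X]) : redPoly p (s * t) = redPoly p s * redPoly p t :=
  Polynomial.map_mul _

theorem redPoly_add (s t : (ZMod (p ^ 2))[X]) : redPoly p (s + t) = redPoly p s + redPoly p t :=
  Polynomial.map_add _

theorem redPoly_one : redPoly p 1 = 1 := Polynomial.map_one _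

theorem redPoly_natCast_self : redPoly p (p : (ZMod (p ^ 2))[X]) = 0 := by
  simp [redPoly]

theorem redPoly_X_pow_sub_one (n : ℕ) :
    redPoly p (X ^ n - 1 : (ZMod (p ^ 2))[X]) = X ^ n - 1 := by
  simp [redPoly]

theorem redPoly_X_sub_one : redPoly p (X - 1 : (ZMod (p ^ 2))[X]) = X - 1 := by
  simp [redPoly]

theorem redPoly_monic {s : (ZMod (p ^ 2))[X]} (hs : s.Monic) : (redPoly p s).Monic :=
  hs.map _

theorem redPoly_dvd {s t : (ZMod (p ^ 2))[X]} (h : s ∣ t) : redPoly p s ∣ redPoly p t :=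
  Polynomial.map_dvd _ h

theorem redPoly_surjective : Function.Surjective (redPoly p) :=
  Polynomial.map_surjective _ (ZMod.castHom_surjective _)

theorem natCast_mul_self_eq_zero : (p : (ZMod (p ^ 2))[X]) * p = 0 := by
  rw [← Nat.cast_mul, ← pow_two, ← C_eq_natCast, ZMod.natCast_self, C_0]

theorem castHom_eq_zero_iff_dvd [NeZero p] (z : ZMod (p ^ 2)) :
    ZMod.castHom (dvd_pow_self p two_ne_zero) (ZMod p) z = 0 ↔ (p : ZMod (p ^ 2)) ∣ z := by
  obtain ⟨k, rfl⟩ := ZMod.natCast_zmod_surjective z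
  rw [map_natCast, ZMod.natCast_eq_zero_iff]
  constructor
  · exact fun h => by exact_mod_cast Nat.cast_dvd_cast (α := ZMod (p ^ 2)) h
  · rintro ⟨w, hw⟩
    have := congrArg (ZMod.castHom (dvd_pow_self p two_ne_zero) (ZMod p)) hw
    rwa [map_mul, map_natCast, map_natCast, ZMod.natCast_self, zero_mul,
      ZMod.natCast_eq_zero_iff] at this

theorem castHom_eq_zero_iff_mul [NeZero p] (z : ZMod (p ^ 2)) :
    ZMod.castHom (dvd_pow_self p two_ne_zero) (ZMod p) z = 0 ↔ (p : ZMod (p ^ 2)) * z = 0 := by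
  obtain ⟨k, rfl⟩ := ZMod.natCast_zmod_surjective z
  rw [map_natCast, ZMod.natCast_eq_zero_iff, ← Nat.cast_mul, ZMod.natCast_eq_zero_iff, pow_two,
    Nat.mul_dvd_mul_iff_left (NeZero.pos p)]

theorem redPoly_eq_zero_iff_dvd [NeZero p] (s : (ZMod (p ^ 2))[X]) :
    redPoly p s = 0 ↔ (p : (ZMod (p ^ 2))[X]) ∣ s := by
  rw [← C_eq_natCast, C_dvd_iff_dvd_coeff, Polynomial.ext_iff]
  refine forall_congr' fun i => ?_
  rw [redPoly, coeff_map, coeff_zero, castHom_eq_zero_iff_dvd]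

theorem redPoly_eq_zero_iff_mul [NeZero p] (s : (ZMod (p ^ 2))[X]) :
    redPoly p s = 0 ↔ (p : (ZMod (p ^ 2))[X]) * s = 0 := by
  rw [← C_eq_natCast, Polynomial.ext_iff, Polynomial.ext_iff]
  refine forall_congr' fun i => ?_
  rw [redPoly, coeff_map, coeff_C_mul, coeff_zero, coeff_zero, castHom_eq_zero_iff_mul]

theorem exists_eq_add_of_redPoly_eq [NeZero p] {s t : (ZMod (p ^ 2))[X]}
    (h : redPoly p s = redPoly p t) : ∃ k, s = t + p * k := by
  have : redPoly p (s - t) = 0 := by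
    rw [redPoly, Polynomial.map_sub]; exact sub_eq_zero.2 h
  obtain ⟨k, hk⟩ := (redPoly_eq_zero_iff_dvd _).1 this
  exact ⟨k, by rw [← hk]; ring⟩

/-- Coprimality lifts along the nilpotent thickening `ℤ/p² → ℤ/p`. -/
theorem isCoprime_of_redPoly [NeZero p] {u v : (ZMod (p ^ 2))[X]}
    (h : IsCoprime (redPoly p u) (redPoly p v)) : IsCoprime u v := by
  obtain ⟨α, β, e⟩ := h
  obtain ⟨α, rfl⟩ := redPoly_surjective α
  obtain ⟨β, rfl⟩ := redPoly_surjective β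
  rw [← redPoly_mul, ← redPoly_mul, ← redPoly_add, ← redPoly_one] at e
  obtain ⟨k, hk⟩ := exists_eq_add_of_redPoly_eq e
  have hpp := natCast_mul_self_eq_zero (p := p)
  -- Since `p² = 0`, the factor `1 - pk` inverts the value `1 + pk` of the lifted Bézout
  -- combination.
  refine ⟨(1 - p * k) * α, (1 - p * k) * β, ?_⟩
  linear_combination (1 - p * k) * hk - k ^ 2 * hpp

/-- A monic polynomial with irreducible reduction that divides `u * v`, where `u` and `v` are
coprime modulo `p`, divides one factor and is coprime to the other. -/
theorem dvd_and_isCoprime_or [Fact p.Prime] {t u v : (ZMod (p ^ 2))[X]}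
    (ht : Irreducible (redPoly p t)) (hd : t ∣ u * v)
    (huv : IsCoprime (redPoly p u) (redPoly p v)) :
    (t ∣ u ∧ IsCoprime t v) ∨ (t ∣ v ∧ IsCoprime t u) := by
  by_cases h : redPoly p t ∣ redPoly p u
  · have hc : IsCoprime t v := isCoprime_of_redPoly (huv.of_isCoprime_of_dvd_left h)
    exact Or.inl ⟨hc.dvd_of_dvd_mul_right hd, hc⟩
  · have hc : IsCoprime t u := isCoprime_of_redPoly (ht.coprime_iff_not_dvd.2 h)
    exact Or.inr ⟨hc.dvd_of_dvd_mul_left hd, hc⟩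

theorem isCoprime_redPoly_of_mul_eq [Fact p.Prime] {n : ℕ} (hn : ¬p ∣ n)
    {u v : (ZMod (p ^ 2))[X]} (h : u * v = X ^ n - 1) :
    IsCoprime (redPoly p u) (redPoly p v) := by
  refine Separable.isCoprime ?_
  rw [← redPoly_mul, h, redPoly_X_pow_sub_one, X_pow_sub_one_separable_iff, Ne,
    ZMod.natCast_eq_zero_iff]
  exact hn

end Reduction

/-! ### Vectors as polynomials modulo `x^n - 1`. -/

section Vectors

variable {A : Type*} [CommRing A] {n : ℕ}

theorem vecToPoly_add (c d : Fin n → A) : vecToPoly (c + d) = vecToPoly c + vecToPoly d := by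
  simp [vecToPoly, add_mul, Finset.sum_add_distrib]

theorem vecToPoly_smul (r : A) (c : Fin n → A) :
    vecToPoly (fun i => r * c i) = C r * vecToPoly c := by
  simp [vecToPoly, Finset.mul_sum, mul_assoc]

theorem vecToPoly_zero : vecToPoly (0 : Fin n → A) = 0 := by
  simp [vecToPoly]

theorem vecToPoly_coeff (c : Fin n → A) (i : Fin n) : (vecToPoly c).coeff i = c i := by
  simp [vecToPoly, coeff_X_pow, Fin.val_inj]

theorem vecToPoly_injective : Function.Injective (vecToPoly : (Fin n → A) → A[X]) :=
  fun c d h => funext fun i => by rw [← vecToPoly_coeff c, h, vecToPoly_coeff]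

theorem degree_vecToPoly_lt (c : Fin n → A) : (vecToPoly c).degree < n :=
  degree_sum_fin_lt c

theorem vecToPoly_coeff_of_degree_lt {s : A[X]} (hs : s.degree < n) :
    vecToPoly (fun i : Fin n => s.coeff i) = s := by
  ext k
  by_cases hk : k < n
  · exact vecToPoly_coeff _ ⟨k, hk⟩
  · have hk' : (n : WithBot ℕ) ≤ k := by exact_mod_cast not_lt.1 hk
    rw [coeff_eq_zero_of_degree_lt (hs.trans_le hk'),
      coeff_eq_zero_of_degree_lt ((degree_vecToPoly_lt _).trans_le hk')]

theorem map_vecToPoly {B : Type*} [CommRing B] (φ : A →+* B) (c : Fin n → A) :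
    (vecToPoly c).map φ = vecToPoly fun i => φ (c i) := by
  simp [vecToPoly, Polynomial.map_sum]

theorem eq_of_dvd_sub_vecToPoly [Nontrivial A] (hn : n ≠ 0) {c d : Fin n → A}
    (h : (X ^ n - 1 : A[X]) ∣ vecToPoly c - vecToPoly d) : c = d := by
  refine vecToPoly_injective (sub_eq_zero.1 ?_)
  by_contra h0
  refine (monic_X_pow_sub_C (1 : A) hn).not_dvd_of_degree_lt h0 ?_ (by simpa using h)
  rw [degree_X_pow_sub_C (Nat.pos_of_ne_zero hn)]
  exact (degree_sub_le _ _).trans_lt (max_lt (degree_vecToPoly_lt c) (degree_vecToPoly_lt d))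

theorem X_pow_sub_one_dvd_X_pow_sub_X_pow_mod (k : ℕ) :
    (X ^ n - 1 : A[X]) ∣ X ^ k - X ^ (k % n) := by
  have h : (X ^ k - X ^ (k % n) : A[X]) = X ^ (k % n) * ((X ^ n) ^ (k / n) - 1 ^ (k / n)) := by
    conv_lhs => rw [← Nat.mod_add_div k n, Nat.add_mul_mod_self_left, Nat.mod_mod]
    rw [pow_add, pow_mul]
    ring
  rw [h]
  exact (sub_dvd_pow_sub_pow _ _ _).mul_left _

/-- Multiplication by `X ^ m` modulo `X ^ n - 1` is the cyclic shift by `m`. -/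
theorem dvd_X_pow_mul_vecToPoly_sub [NeZero n] (m : ℕ) (c : Fin n → A) :
    (X ^ n - 1 : A[X]) ∣ X ^ m * vecToPoly c - vecToPoly fun i => c (i - Fin.ofNat n m) := by
  have h : vecToPoly (fun i => c (i - Fin.ofNat n m)) =
      ∑ i : Fin n, C (c i) * X ^ ((i + m) % n) := by
    rw [vecToPoly, ← Equiv.sum_comp (Equiv.addRight (Fin.ofNat n m))]
    refine Finset.sum_congr rfl fun i _ => ?_
    simp [Fin.val_add]
  rw [h, vecToPoly, Finset.mul_sum, ← Finset.sum_sub_distrib]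
  refine Finset.dvd_sum fun i _ => ?_
  have e : (X ^ m * (C (c i) * X ^ (i : ℕ)) - C (c i) * X ^ ((i + m) % n) : A[X]) =
      C (c i) * (X ^ (i + m : ℕ) - X ^ ((i + m) % n)) := by ring
  rw [e]
  exact (X_pow_sub_one_dvd_X_pow_sub_X_pow_mod _).mul_left _

theorem dvd_X_pow_sub_one_mul_vecToPoly_iff [Nontrivial A] [NeZero n] (m : ℕ) (c : Fin n → A) :
    (X ^ n - 1 : A[X]) ∣ (X ^ m - 1) * vecToPoly c ↔ ∀ i, c (i - Fin.ofNat n m) = c i := by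
  have h := dvd_X_pow_mul_vecToPoly_sub m c
  constructor
  · intro h'
    have := eq_of_dvd_sub_vecToPoly (NeZero.ne n) (c := fun i => c (i - Fin.ofNat n m)) (d := c)
      (by convert dvd_sub h' h using 1; ring)
    exact congrFun this
  · intro h'
    rw [funext h'] at h
    convert h using 1
    ring

end Vectors

/-! ### Residue and torsion codes. -/

/-- The vector of carries of the coordinatewise addition of two vectors of base-`p` digits. -/
def carryVec {p n : ℕ} (c d : Fin n → ZMod p) : Fin n → ZMod p :=
  fun i => (((c i).val + (d i).val) / p : ℕ)

theorem carryVec_zero_left {p n : ℕ} [NeZero p] (d : Fin n → ZMod p) : carryVec 0 d = 0 := by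
  funext i
  simp [carryVec, Nat.div_eq_of_lt (ZMod.val_lt (d i))]

theorem mem_cyclicCode_iff {R : Type*} [CommRing R] {n : ℕ} {s : R[X]} {c : Fin n → R} :
    c ∈ cyclicCode n s ↔ vecToPoly c ∈ Ideal.span {s, X ^ n - 1} := by
  have h : Ideal.span {Ideal.Quotient.mk (Ideal.span {(X ^ n - 1 : R[X])}) s} =
      (Ideal.span {s}).map (Ideal.Quotient.mk (Ideal.span {(X ^ n - 1 : R[X])})) := by
    rw [Ideal.map_span, Set.image_singleton]
  rw [cyclicCode, Set.mem_ofPred_eq, h, Ideal.mem_quotient_iff_mem_sup, Ideal.span_insert]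

/-- The additive group of vectors whose polynomial lies in an ideal. -/
noncomputable def idealCode {R : Type*} [CommRing R] (n : ℕ) (I : Ideal R[X]) : AddSubgroup (Fin n → R) :=
  I.toAddSubgroup.comap
    { toFun := vecToPoly, map_zero' := vecToPoly_zero, map_add' := vecToPoly_add }

theorem mem_idealCode {R : Type*} [CommRing R] {n : ℕ} {I : Ideal R[X]} {c : Fin n → R} :
    c ∈ idealCode n I ↔ vecToPoly c ∈ I := Iff.rfl

section

variable {p : ℕ} [Fact p.Prime] {n : ℕ} {f g h : (ZMod (p ^ 2))[X]}

/-- Modulo `x^n - 1 = fhg`, multiplying the generator by `g` gives `pfg`, and by `p` gives `pfh`;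
since `g` and `h` are coprime, these combine to `pf`. -/
theorem span_generator_eq (hn : ¬p ∣ n) (hfgh : f * h * g = X ^ n - 1) :
    Ideal.span {f * h + (p : (ZMod (p ^ 2))[X]) * f, X ^ n - 1} =
      Ideal.span {f * h, (p : (ZMod (p ^ 2))[X]) * f} := by
  have hpp := natCast_mul_self_eq_zero (p := p)
  have hc : IsCoprime g h := by
    have h1 := isCoprime_redPoly_of_mul_eq hn hfgh
    rw [redPoly_mul] at h1
    exact isCoprime_of_redPoly h1.symm.of_mul_right_right
  obtain ⟨α, β, e⟩ := hc
  apply le_antisymm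
  · rw [Ideal.span_le]
    rintro x (rfl | rfl)
    · exact Ideal.mem_span_pair.2 ⟨1, 1, by ring⟩
    · exact Ideal.mem_span_pair.2 ⟨g, 0, by rw [← hfgh]; ring⟩
  · rw [Ideal.span_le]
    rintro x (rfl | rfl)
    · refine Ideal.mem_span_pair.2 ⟨1 - (α * g + β * p), α, ?_⟩
      rw [← hfgh]
      linear_combination (-p * f) * e - β * f * hpp
    · refine Ideal.mem_span_pair.2 ⟨α * g + β * p, -α, ?_⟩
      rw [← hfgh]
      linear_combination (p * f) * e + β * f * hpp

theorem redPoly_dvd_of_mem_span {s : (ZMod (p ^ 2))[X]}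
    (hs : s ∈ Ideal.span {f * h, (p : (ZMod (p ^ 2))[X]) * f}) :
    redPoly p (f * h) ∣ redPoly p s := by
  obtain ⟨u, v, rfl⟩ := Ideal.mem_span_pair.1 hs
  rw [redPoly_add, redPoly_mul u, redPoly_mul v, redPoly_mul (p : (ZMod (p ^ 2))[X]),
    redPoly_natCast_self, zero_mul, mul_zero, add_zero]
  exact dvd_mul_left _ _

/-- This identifies the torsion code. If `ps = f(uh + pv)`, the monic `f` cancels modulo `p`, so `uh
+ pv = pk` and `p` kills `s - fk`. -/
theorem natCast_mul_mem_span_iff (hf : f.Monic) (s : (ZMod (p ^ 2))[X]) :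
    (p : (ZMod (p ^ 2))[X]) * s ∈ Ideal.span {f * h, (p : (ZMod (p ^ 2))[X]) * f} ↔
      redPoly p f ∣ redPoly p s := by
  constructor
  · intro hs
    obtain ⟨u, v, e⟩ := Ideal.mem_span_pair.1 hs
    have e1 : (p : (ZMod (p ^ 2))[X]) * s = f * (u * h + p * v) := by rw [← e]; ring
    have e2 : redPoly p f * redPoly p (u * h + p * v) = 0 := by
      rw [← redPoly_mul, ← e1, redPoly_mul, redPoly_natCast_self, zero_mul]
    obtain ⟨k, hk⟩ := (redPoly_eq_zero_iff_dvd _).1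
      ((mul_eq_zero.1 e2).resolve_left (redPoly_monic hf).ne_zero)
    have e3 : redPoly p (s - f * k) = 0 := by
      rw [redPoly_eq_zero_iff_mul, mul_sub, e1, hk]
      ring
    rw [redPoly, Polynomial.map_sub, sub_eq_zero] at e3
    rw [redPoly, redPoly, e3, Polynomial.map_mul]
    exact dvd_mul_right _ _
  · rintro ⟨k, hk⟩
    obtain ⟨k, rfl⟩ := redPoly_surjective k
    rw [← redPoly_mul] at hk
    obtain ⟨t, rfl⟩ := exists_eq_add_of_redPoly_eq hk
    refine Ideal.mem_span_pair.2 ⟨0, k, ?_⟩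
    linear_combination (-t) * natCast_mul_self_eq_zero (p := p)

/-- Every codeword of the residue code `⟨fh mod p⟩` is the reduction of a codeword. -/
theorem exists_lift_mem_span [NeZero n] (hfgh : f * h * g = X ^ n - 1) (c : Fin n → ZMod p)
    (hc : redPoly p (f * h) ∣ vecToPoly c) :
    ∃ c' : Fin n → ZMod (p ^ 2),
      vecToPoly c' ∈ Ideal.span {f * h, (p : (ZMod (p ^ 2))[X]) * f} ∧
      (fun i => ZMod.castHom (dvd_pow_self p two_ne_zero) (ZMod p) (c' i)) = c := by
  have : Fact (1 < p) := ⟨(Fact.out : p.Prime).one_lt⟩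
  have : Fact (1 < p ^ 2) := ⟨Nat.one_lt_pow two_ne_zero this.out⟩
  obtain ⟨k, hk⟩ := hc
  obtain ⟨k, rfl⟩ := redPoly_surjective k
  have hm : (X ^ n - 1 : (ZMod (p ^ 2))[X]).Monic := by
    simpa using monic_X_pow_sub_C (1 : ZMod (p ^ 2)) (NeZero.ne n)
  have hdeg : ((f * h * k) %ₘ (X ^ n - 1)).degree < n := by
    refine (degree_modByMonic_lt _ hm).trans_eq ?_
    simpa using degree_X_pow_sub_C (NeZero.pos n) (1 : ZMod (p ^ 2))
  have hv := vecToPoly_coeff_of_degree_lt hdeg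
  refine ⟨fun i => ((f * h * k) %ₘ (X ^ n - 1)).coeff i, ?_, ?_⟩
  · rw [hv, modByMonic_eq_sub_mul_div, ← hfgh]
    exact Ideal.mem_span_pair.2 ⟨k - g * (f * h * k /ₘ (f * h * g)), 0, by ring⟩
  · refine eq_of_dvd_sub_vecToPoly (NeZero.ne n) ?_
    rw [← map_vecToPoly, hv, hk, ← redPoly_mul, modByMonic_eq_sub_mul_div]
    generalize f * h * k /ₘ (X ^ n - 1) = r
    refine ⟨-redPoly p r, ?_⟩
    rw [← redPoly_X_pow_sub_one (p := p)]
    simp only [redPoly, Polynomial.map_sub, Polynomial.map_mul]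
    ring

/-- The Gray image of `⟨fh + pf⟩` is linear exactly when the carry vector of any two codewords
of the residue code `⟨fh mod p⟩` lies in the torsion code `⟨f mod p⟩`. -/
theorem isLinearCode_iff_dvd_carryVec [NeZero n] (hn : ¬p ∣ n) (hf : f.Monic)
    (hfgh : f * h * g = X ^ n - 1) :
    IsLinearCode (grayMapVec p n '' cyclicCode n (f * h + (p : (ZMod (p ^ 2))[X]) * f)) ↔
      ∀ c d : Fin n → ZMod p, redPoly p (f * h) ∣ vecToPoly c → redPoly p (f * h) ∣ vecToPoly d →
        redPoly p f ∣ vecToPoly (carryVec c d) := by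
  have hC : cyclicCode n (f * h + (p : (ZMod (p ^ 2))[X]) * f) =
      idealCode n (Ideal.span {f * h, (p : (ZMod (p ^ 2))[X]) * f}) := by
    ext c
    rw [mem_cyclicCode_iff, span_generator_eq hn hfgh]
    exact mem_idealCode.symm
  rw [hC, isLinearCode_grayMapVec_image_iff (Fact.out : p.Prime).one_lt]
  have key : ∀ c d : Fin n → ZMod (p ^ 2),
      (fun i => (p : ZMod (p ^ 2)) * (digitCarry p (c i) (d i) : ℕ)) ∈
        idealCode n (Ideal.span {f * h, (p : (ZMod (p ^ 2))[X]) * f}) ↔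
      redPoly p f ∣ vecToPoly (carryVec
        (fun i => ZMod.castHom (dvd_pow_self p two_ne_zero) (ZMod p) (c i))
        (fun i => ZMod.castHom (dvd_pow_self p two_ne_zero) (ZMod p) (d i))) := by
    intro c d
    rw [mem_idealCode, vecToPoly_smul, C_eq_natCast, natCast_mul_mem_span_iff hf, redPoly.eq_def p
      (vecToPoly _), map_vecToPoly]
    simp only [map_natCast, digitCarry_eq]
    rfl
  constructor
  · intro H c d hc hd
    obtain ⟨c', hc', rfl⟩ := exists_lift_mem_span hfgh c hc
    obtain ⟨d', hd', rfl⟩ := exists_lift_mem_span hfgh d hd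
    exact (key c' d').1 (H c' hc' d' hd')
  · intro H c hc d hd
    refine (key c d).2 (H _ _ ?_ ?_) <;> rw [← map_vecToPoly]
    · exact redPoly_dvd_of_mem_span hc
    · exact redPoly_dvd_of_mem_span hd

end

/-! ### Carries of periodic words and of doubled words. -/

/-- Carry vectors of shift-invariant vectors are shift-invariant. -/
theorem dvd_vecToPoly_carryVec {p n m : ℕ} [Fact p.Prime] [NeZero n] (hm : m ≠ 0) {u : (ZMod p)[X]}
    (hu : u * (X ^ m - 1) = X ^ n - 1) {c d : Fin n → ZMod p} (hc : u ∣ vecToPoly c)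
    (hd : u ∣ vecToPoly d) : u ∣ vecToPoly (carryVec c d) := by
  have hX : (X ^ m - 1 : (ZMod p)[X]) ≠ 0 := by
    simpa using (monic_X_pow_sub_C (1 : ZMod p) hm).ne_zero
  have key : ∀ w : Fin n → ZMod p, u ∣ vecToPoly w ↔ ∀ i, w (i - Fin.ofNat n m) = w i := by
    intro w
    rw [← dvd_X_pow_sub_one_mul_vecToPoly_iff, ← hu, mul_comm u, mul_dvd_mul_iff_left hX]
  rw [key] at hc hd ⊢
  intro i
  simp only [carryVec, hc i, hd i]

/-- A vector with entries in `{1, 0, -1}` added to itself has carries exactly at the entries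
`-1`. -/
theorem carryVec_self_of_sub {p n : ℕ} (hp : 2 < p) (P Q : Fin n → Prop)
    [DecidablePred P] [DecidablePred Q] (hPQ : ∀ i, P i → ¬Q i) {c : Fin n → ZMod p}
    (hc : ∀ i, c i = (if P i then 1 else 0) - (if Q i then 1 else 0)) :
    carryVec c c = fun i => if Q i then 1 else 0 := by
  obtain ⟨k, rfl⟩ : ∃ k, p = k + 3 := ⟨p - 3, by omega⟩
  have h1 : (1 : ZMod (k + 3)).val = 1 := rfl
  have h2 : (-1 : ZMod (k + 3)).val = k + 2 := ZMod.val_neg_one (k + 2)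
  funext i
  by_cases hQ : Q i
  · have hP : ¬P i := fun h => hPQ i h hQ
    have h3 : (k + 2 + (k + 2)) / (k + 3) = 1 :=
      Nat.div_eq_of_lt_le (by omega) (by omega)
    simp only [carryVec, hc, hP, hQ, if_true, if_false, zero_sub, h2, h3, Nat.cast_one]
  · by_cases hP : P i
    · have h3 : (1 + 1) / (k + 3) = 0 := Nat.div_eq_of_lt (by omega)
      simp only [carryVec, hc, hP, hQ, if_true, if_false, sub_zero, h1, h3, Nat.cast_zero]
    · simp [carryVec, hc, hP, hQ]

/-- Computes the coefficients of `x^r (1 + x^q + ⋯ + x^((q-1)q))`; needed for `r = 0, 1`. -/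
theorem sum_range_ite_eq_mul_add {A : Type*} [CommRing A] {q i r : ℕ} (hi : i < q ^ 2)
    (hr : r < q) :
    (∑ k ∈ Finset.range q, if i = k * q + r then (1 : A) else 0) = if i % q = r then 1 else 0 := by
  have h : ∀ k, i = k * q + r ↔ k = i / q ∧ i % q = r := by
    intro k
    constructor
    · rintro rfl
      rw [mul_comm, Nat.mul_add_div (by omega), Nat.mul_add_mod, Nat.div_eq_of_lt hr,
        Nat.mod_eq_of_lt hr]
      simp
    · rintro ⟨rfl, h⟩
      have := Nat.div_add_mod' i q
      omega
  have hlt : i / q < q := Nat.div_lt_of_lt_mul (by rwa [← pow_two])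
  simp only [h]
  by_cases h0 : i % q = r <;> simp [h0, hlt]

theorem X_sub_one_mul_sum_range {A : Type*} [CommRing A] (q : ℕ) :
    (X - 1) * ∑ i ∈ Finset.range q, X ^ i = (X ^ q - 1 : A[X]) := mul_geom_sum X q

theorem X_pow_sub_one_mul_sum_range {A : Type*} [CommRing A] (q : ℕ) :
    (X ^ q - 1) * ∑ i ∈ Finset.range q, X ^ (i * q) = (X ^ (q ^ 2) - 1 : A[X]) := by
  have h := mul_geom_sum (X ^ q : A[X]) q
  simp only [← pow_mul] at h
  rw [pow_two, ← h]
  simp only [mul_comm]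

theorem natDegree_sum_range_X_pow_mul {A : Type*} [CommRing A] [Nontrivial A] {q : ℕ} (hq : 1 < q) :
    (∑ i ∈ Finset.range q, X ^ (i * q) : A[X]).natDegree + q = q ^ 2 := by
  have hm : (X ^ q - 1 : A[X]).Monic := by
    simpa using monic_X_pow_sub_C (1 : A) (by omega : q ≠ 0)
  have h := congrArg natDegree (X_pow_sub_one_mul_sum_range (A := A) q)
  have h0 : (∑ i ∈ Finset.range q, X ^ (i * q) : A[X]) ≠ 0 := by
    intro h0
    rw [h0, mul_zero] at h
    refine (monic_X_pow_sub_C (1 : A) (pow_ne_zero 2 (by omega : q ≠ 0))).ne_zero ?_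
    rw [C_1, ← X_pow_sub_one_mul_sum_range, h0, mul_zero]
  rw [hm.natDegree_mul' h0, ← C_1, natDegree_X_pow_sub_C, natDegree_X_pow_sub_C] at h
  omega

theorem vecToPoly_mod_eq_zero {A : Type*} [CommRing A] [Nontrivial A] {q : ℕ} (hq : 1 < q) :
    vecToPoly (fun i : Fin (q ^ 2) => if (i : ℕ) % q = 0 then (1 : A) else 0) =
      ∑ i ∈ Finset.range q, X ^ (i * q) := by
  have hd := natDegree_sum_range_X_pow_mul (A := A) hq
  rw [← vecToPoly_coeff_of_degree_lt (n := q ^ 2) (s := ∑ i ∈ Finset.range q, X ^ (i * q))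
    (degree_le_natDegree.trans_lt (by exact_mod_cast (by omega :
      (∑ i ∈ Finset.range q, X ^ (i * q) : A[X]).natDegree < q ^ 2)))]
  congr 1
  funext i
  rw [finsetSum_coeff, ← sum_range_ite_eq_mul_add i.2 (by omega)]
  simp [coeff_X_pow]

/-- If the residue code contains `x^q - 1` and the carry condition holds, the torsion code is
everything. -/
theorem dvd_one_of_dvd_X_pow_sub_one {p n m : ℕ} (hp : 2 < p) (hm : m ≠ 0) (hmn : m < n)
    {u v : (ZMod p)[X]} (huv : u ∣ X ^ m - 1)
    (H : ∀ c : Fin n → ZMod p, u ∣ vecToPoly c → v ∣ vecToPoly (carryVec c c)) : v ∣ 1 := by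
  have : Fact (1 < p) := ⟨by omega⟩
  have : NeZero n := ⟨by omega⟩
  have hd : (X ^ m - 1 : (ZMod p)[X]).degree < n := by
    rw [← C_1, degree_X_pow_sub_C (Nat.pos_of_ne_zero hm)]
    exact_mod_cast hmn
  have hv := vecToPoly_coeff_of_degree_lt hd
  rw [← hv] at huv
  have h := H _ huv
  -- The only `-1` of `x^m - 1` is at position `0`, so the carry polynomial is `1`.
  rw [carryVec_self_of_sub hp (fun i => (i : ℕ) = m) (fun i => (i : ℕ) = 0)
    (fun i h => by omega) (fun i => by rw [coeff_sub, coeff_X_pow, coeff_one])] at h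
  convert h using 1
  have : ∀ i : Fin n, (i : ℕ) = 0 ↔ i = 0 := fun i => by rw [Fin.ext_iff]; rfl
  simp [vecToPoly, this]

/-- Doubling `(x - 1)B`, with `1` at `i ≡ 1` and `-1` at `i ≡ 0` modulo `q`, yields the carry
polynomial `B`; but `B(1) = q ≠ 0` in `𝔽_p`. -/
theorem not_X_sub_one_dvd_of_dvd {p q : ℕ} [Fact p.Prime] (hp : 2 < p) (hq : 1 < q) (hpq : ¬p ∣ q)
    {u v : (ZMod p)[X]} (huv : u ∣ (X - 1) * ∑ i ∈ Finset.range q, X ^ (i * q))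
    (H : ∀ c : Fin (q ^ 2) → ZMod p, u ∣ vecToPoly c → v ∣ vecToPoly (carryVec c c)) :
    ¬X - 1 ∣ v := by
  intro hv1
  set B : (ZMod p)[X] := ∑ i ∈ Finset.range q, X ^ (i * q) with hB
  have hBd : B.natDegree + q = q ^ 2 := natDegree_sum_range_X_pow_mul hq
  have hd : (X * B - B).degree < ((q ^ 2 : ℕ) : WithBot ℕ) := by
    refine degree_le_natDegree.trans_lt ?_
    have h1 : (X * B - B).natDegree ≤ 1 + B.natDegree := by
      rw [← sub_one_mul]
      exact natDegree_mul_le_of_le (natDegree_X_sub_C (1 : ZMod p)).le le_rfl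
    exact Nat.cast_lt.2 (h1.trans_lt (by omega))
  have hv := vecToPoly_coeff_of_degree_lt hd
  rw [sub_one_mul, ← hv] at huv
  have h := H _ huv
  rw [carryVec_self_of_sub hp (fun i => (i : ℕ) % q = 1) (fun i => (i : ℕ) % q = 0)
    (fun i h => by omega) (fun i => by
      rw [← sum_range_ite_eq_mul_add i.2 hq, ← sum_range_ite_eq_mul_add i.2 (by omega : 0 < q),
        coeff_sub, hB, Finset.mul_sum, finsetSum_coeff, finsetSum_coeff]
      simp [coeff_X_pow, ← pow_succ']), vecToPoly_mod_eq_zero hq] at h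
  have h1 := hv1.trans h
  rw [← C_1, dvd_iff_isRoot, IsRoot, eval_finsetSum] at h1
  simp only [eval_pow, eval_X, one_pow, Finset.sum_const, Finset.card_range, nsmul_eq_mul,
    mul_one, ZMod.natCast_eq_zero_iff] at h1
  exact hpq h1

/-! ### Monic divisors and the final case analysis. -/

theorem eq_one_of_monic_of_dvd_one {A : Type*} [CommRing A] {f : A[X]} (hf : f.Monic) (h : f ∣ 1) :
    f = 1 :=
  hf.eq_one_of_isUnit (isUnit_of_dvd_one h)

theorem eq_one_of_redPoly_dvd_one {p : ℕ} [Fact p.Prime] {f : (ZMod (p ^ 2))[X]} (hf : f.Monic)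
    (h : redPoly p f ∣ 1) : f = 1 := by
  have h1 := congrArg natDegree (eq_one_of_monic_of_dvd_one (redPoly_monic hf) h)
  rw [redPoly, hf.natDegree_map, natDegree_one] at h1
  exact hf.natDegree_eq_zero.1 h1

theorem eq_one_or_eq_of_monic_of_dvd_X_sub_one {A : Type*} [CommRing A] [Nontrivial A] {f : A[X]}
    (hf : f.Monic) (h : f ∣ X - 1) : f = 1 ∨ f = X - 1 := by
  obtain ⟨k, hk⟩ := h
  have hX : (X - 1 : A[X]).Monic := monic_X_sub_C 1
  have hkm : k.Monic := hf.of_mul_monic_left (hk ▸ hX)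
  have hd := congrArg natDegree hk
  rw [hf.natDegree_mul hkm, ← C_1, natDegree_X_sub_C] at hd
  rcases Nat.eq_zero_or_pos f.natDegree with h0 | h0
  · exact Or.inl (hf.natDegree_eq_zero.1 h0)
  · have : k = 1 := hkm.natDegree_eq_zero.1 (by omega)
    right
    rw [hk, this, mul_one]

theorem mainTheorem9 (p q : ℕ) (hp : p.Prime) (hp_odd : Odd p) (hq : q.Prime) (hpq : p ≠ q)
    (a b : (ZMod (p ^ 2))[X]) (ha_monic : a.Monic) (hb_monic : b.Monic)
    (hab : (X ^ (q ^ 2) - 1 : (ZMod (p ^ 2))[X]) = (X - 1) * a * b)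
    (ha : redPoly p a = ∑ i ∈ Finset.range q, X ^ i)
    (hb : redPoly p b = ∑ i ∈ Finset.range q, X ^ (i * q))
    (ha_irr : Irreducible (redPoly p a)) (hb_irr : Irreducible (redPoly p b))
    (f g h : (ZMod (p ^ 2))[X]) (hf_monic : f.Monic) (hg_monic : g.Monic) (hh_monic : h.Monic)
    (hfgh : f * h * g = X ^ (q ^ 2) - 1) :
    ((f = 1 ∨ g = 1 ∨ g = X - 1) →
      IsLinearCode (grayMapVec p (q ^ 2) '' cyclicCode (q ^ 2) (f * h + (p : (ZMod (p ^ 2))[X]) * f))) ∧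
    (f ≠ 1 → g ≠ 1 → g ≠ X - 1 →
      (IsLinearCode (grayMapVec p (q ^ 2) '' cyclicCode (q ^ 2) (f * h + (p : (ZMod (p ^ 2))[X]) * f)) ↔
        f = b ∧ (g = a ∨ g = (X - 1) * a))) := by
  have : Fact p.Prime := ⟨hp⟩
  have : Fact (1 < p ^ 2) := ⟨Nat.one_lt_pow two_ne_zero hp.one_lt⟩
  have : NeZero (q ^ 2) := ⟨pow_ne_zero 2 hq.ne_zero⟩
  have hp2 : 2 < p := by
    have := hp.two_le
    obtain ⟨k, hk⟩ := hp_odd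
    omega
  have hpq' : ¬p ∣ q := fun hd => hpq ((Nat.prime_dvd_prime_iff_eq hp hq).1 hd)
  have hn : ¬p ∣ q ^ 2 := fun hd => hpq' (hp.dvd_of_dvd_pow hd)
  have hqn : q < q ^ 2 := by have := hq.one_lt; nlinarith
  have hredX : redPoly p (X - 1 : (ZMod (p ^ 2))[X]) = X - 1 := redPoly_X_sub_one
  rw [isLinearCode_iff_dvd_carryVec hn hf_monic hfgh]
  constructor
  · rintro (rfl | rfl | rfl) c d hc hd
    · rw [redPoly_one]
      exact one_dvd _
    · rw [mul_one] at hfgh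
      rw [hfgh, redPoly_X_pow_sub_one] at hc
      have h0 : c = 0 := eq_of_dvd_sub_vecToPoly (NeZero.ne _) (by rwa [vecToPoly_zero, sub_zero])
      rw [h0, carryVec_zero_left, vecToPoly_zero]
      exact dvd_zero _
    · refine (redPoly_dvd (dvd_mul_right f h)).trans
        (dvd_vecToPoly_carryVec one_ne_zero ?_ hc hd)
      rw [pow_one, ← hredX, ← redPoly_mul, hfgh, redPoly_X_pow_sub_one]
  intro hf1 hg1 hgX
  constructor
  swap
  · rintro ⟨rfl, -⟩ c d hc hd
    have hfh := redPoly_dvd (dvd_mul_right f h)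
    refine dvd_vecToPoly_carryVec hq.ne_zero ?_ (hfh.trans hc) (hfh.trans hd)
    rw [hb, mul_comm, X_pow_sub_one_mul_sum_range]
  intro H
  have hcop : IsCoprime (redPoly p g) (redPoly p (f * h)) :=
    (isCoprime_redPoly_of_mul_eq hn hfgh).symm
  have hcop' : IsCoprime (redPoly p f) (redPoly p (h * g)) :=
    isCoprime_redPoly_of_mul_eq hn (by rw [← hfgh, mul_assoc])
  have hadvd : a ∣ g * (f * h) := ⟨(X - 1) * b, by linear_combination hfgh + hab⟩
  have hbdvd : b ∣ g * (f * h) := ⟨(X - 1) * a, by linear_combination hfgh + hab⟩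
  have hgdvd : g ∣ (X - 1) * a * b := ⟨f * h, by linear_combination -hfgh - hab⟩
  -- If `b ∣ g`, then `fh` divides `(x - 1)a`, which reduces to `x^q - 1`.
  rcases dvd_and_isCoprime_or hb_irr hbdvd hcop with ⟨⟨g₁, rfl⟩, -⟩ | ⟨-, hbg⟩
  · refine absurd (eq_one_of_redPoly_dvd_one hf_monic ?_) hf1
    refine dvd_one_of_dvd_X_pow_sub_one hp2 hq.ne_zero hqn ?_ fun c hc => H c c hc hc
    have e : f * h * g₁ = (X - 1) * a :=
      hb_monic.isRegular.right (by simp only; linear_combination hfgh + hab)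
    rw [← X_sub_one_mul_sum_range, ← ha, ← hredX, ← redPoly_mul, ← e]
    exact redPoly_dvd (dvd_mul_right _ _)
  have hgdvd' : g ∣ (X - 1) * a := hbg.symm.dvd_of_dvd_mul_right hgdvd
  -- Now `g ∣ (x - 1)a`; if `a ∤ g`, only the excluded values `1` and `x - 1` remain.
  rcases dvd_and_isCoprime_or ha_irr hadvd hcop with ⟨⟨g₁, rfl⟩, -⟩ | ⟨-, hag⟩
  swap
  · rcases eq_one_or_eq_of_monic_of_dvd_X_sub_one hg_monic (hag.symm.dvd_of_dvd_mul_right hgdvd')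
      with h1 | h1
    · exact absurd h1 hg1
    · exact absurd h1 hgX
  have hg₁ : g₁.Monic := ha_monic.of_mul_monic_left hg_monic
  have hfX : ∀ k, X - 1 ∣ f → f * h * k = (X - 1) * b → False := by
    intro k hX hk
    refine not_X_sub_one_dvd_of_dvd hp2 hq.one_lt hpq' ?_ (fun c hc => H c c hc hc)
      (hredX ▸ redPoly_dvd hX)
    rw [← hb, ← hredX, ← redPoly_mul, ← hk]
    exact redPoly_dvd (dvd_mul_right _ _)
  have e : f * h * g₁ = (X - 1) * b :=
    ha_monic.isRegular.left (by simp only; linear_combination hfgh + hab)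
  have hg₁X : g₁ = 1 ∨ g₁ = X - 1 := by
    obtain ⟨k, hk⟩ := hgdvd'
    refine eq_one_or_eq_of_monic_of_dvd_X_sub_one hg₁ ⟨k, ?_⟩
    exact ha_monic.isRegular.left (by simp only; linear_combination hk)
  have hX1 : ¬X - 1 ∣ f := fun hX => hfX g₁ hX e
  refine ⟨?_, ?_⟩
  · have hbf : b ∣ f * (h * (a * g₁)) := ⟨(X - 1) * a, by linear_combination hfgh + hab⟩
    -- Either `f = b f₁` with `f₁ ∣ x - 1`, or `f ∣ x - 1`; as `f ≠ 1` and `x - 1 ∤ f`, only `f = b`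
    -- is left.
    rcases dvd_and_isCoprime_or hb_irr hbf hcop' with ⟨⟨f₁, rfl⟩, -⟩ | ⟨-, hbf⟩
    · have hf₁ : f₁.Monic := hb_monic.of_mul_monic_left hf_monic
      have e1 : f₁ * (h * g₁) = X - 1 :=
        hb_monic.isRegular.left (by simp only; linear_combination e)
      rcases eq_one_or_eq_of_monic_of_dvd_X_sub_one hf₁ ⟨_, e1.symm⟩ with rfl | rfl
      · rw [mul_one]
      · exact absurd (dvd_mul_left _ _) hX1
    · have h1 : f ∣ X - 1 := hbf.symm.dvd_of_dvd_mul_right ⟨h * g₁, by rw [← e, mul_assoc]⟩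
      rcases eq_one_or_eq_of_monic_of_dvd_X_sub_one hf_monic h1 with h1 | h1
      · exact absurd h1 hf1
      · exact absurd (h1 ▸ dvd_rfl) hX1
  · rcases hg₁X with rfl | rfl
    · exact Or.inl (mul_one a)
    · exact Or.inr (mul_comm _ _)
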